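/- **Setting.** Let $\Sigma=(A,G,\alpha,\sigma)$ be a twisted unital discrete $C^*$-dynamical system: $A$ is a unital $C^*$-algebra, $G$ a discrete group with identity $e$, and $\alpha:G\to\mathrm{Aut}(A)$, $\sigma:G\times G\to\mathcal U(A)$ are maps with $$\alpha_g\circ\alpha_h=\mathrm{Ad}(\sigma(g,h))\circ\alpha_{gh},\qquad \sigma(g,h)\,\sigma(gh,k)=\alpha_g(\sigma(h,k))\,\sigma(g,hk),\qquad \sigma(g,e)=\sigma(e,g)=1$$ for all $g,h,k\in G$. Let $A$ act faithfully (and unitally) on a Hilbert space $\mathcal H$. On $\ell^2(G,\mathcal H)$ put $$(\pi(a)\xi)(h)=\alpha_{h^{-1}}(a)\,\xi(h),\qquad(\lambda(g)\xi)(h)=\sigma(h^{-1},g)\,\xi(g^{-1}h)\qquad(a\in A,\ g,h\in G).$$ The reduced crossed product $C_r^*(\Sigma)$ is the $C^*$-algebra generated by $\pi(A)$ and the unitaries $\lambda(g)$, $g\in G$. Identify $A$ with $\pi(A)$, and let $E:C_r^*(\Sigma)\to A$ be the canonical conditional expectation, determined by continuity and linearity by $E(\pi(a)\lambda(g))=a$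 if $g=e$ and $0$ otherwise. Let $\mathcal U_\Sigma$ be the unitary group of $C_r^*(\Sigma)$ and $\mathcal U_G$ its subgroup generated by the unitaries $\lambda(g)$, $g\in G$. $\Sigma$ has *property (DP)* if $$0\in\overline{\mathrm{co}\{v\,y\,v^*\mid v\in\mathcal U_\Sigma\}}^{\,\|\cdot\|}\qquad\text{for every } y=y^*\in C_r^*(\Sigma)\text{ with }E(y)=0,$$ and the *strong form of property (DP)* if the same holds with $\mathcal U_G$ in place of $\mathcal U_\Sigma$. **The class $\mathcal P$.** For $T\subseteq G$ and $\emptyset\ne M\subseteq G\setminus\{e\}$, $T$ is *$M$-large* if $m(G\setminus T)\subseteq T$ for all $m\in M$. A subset $H\subseteq G$ is a *Powers set* for $\emptyset\ne F\subseteq G\setminus\{e\}$ if for every $N\in\mathbb N$ there are $h_1,\dots,h_N\in H$ and pairwise disjoint $T_1,\dots,T_N\subseteq G$ such that $T_j$ is $h_jFh_j^{-1}$-large for every $j$. It is a *c-Powers set* for $g\in G\setminus\{e\}$ if it is a Powers set for $\{mgm^{-1}\mid m\in M\}$ for every finite nonempty $M\subseteq H$. The group $G$ is a *PH group* if every finite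 nonempty $F\subseteq G\setminus\{e\}$ can be written as $F=\{f_1,\dots,f_n\}$ so that there are subgroups $G_1\subseteq\cdots\subseteq G_n$ of $G$ with $G_j$ a c-Powers set for $f_j$, $j=1,\dots,n$. The group $G$ has *property $(P_{\rm com})$* if for every finite nonempty $F\subseteq G\setminus\{e\}$ there are $n\in\mathbb N$, $g_0\in G$ and $U,D_1,\dots,D_n\subseteq G$ with $G\setminus U\subseteq D_1\cup\dots\cup D_n$; $gU\cap U=\emptyset$ for all $g\in F$; and $g_0^{-j}D_k\cap D_k=\emptyset$ for all integers $j\ge1$ and $k=1,\dots,n$. Let $\mathcal P$ be the class of groups that are PH groups or have property $(P_{\rm com})$. **Theorem.** If $G\in\mathcal P$, then every twisted unital discrete $C^*$-dynamical system $\Sigma=(A,G,\alpha,\sigma)$ over $G$ has property (DP), and indeed its strong form: for every self-adjoint $y\in C_r^*(\Sigma)$ with $E(y)=0$, $$0\in\overline{\mathrm{co}\{v\,y\,v^*\mid v\in\mathcal U_G\}}^{\,\|\cdot\|}.$$ -/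

import Mathlib

/-!
Twisted unital discrete C*-dynamical systems, their reduced crossed products in a regular
representation, the canonical conditional expectation, property (DP) and its strong form,
and the classes of PH groups and of groups with property (P_com).
-/

/-! ### Group-theoretic notions -/

section GroupNotions

variable {G : Type*} [Group G]

/-- The set `⟨g⟩_M = {m g m⁻¹ | m ∈ M}` of conjugates of `g` by elements of `M`. -/
def conjugatesBy (g : G) (M : Set G) : Set G := {x | ∃ m ∈ M, x = m * g * m⁻¹}

/-- `T` is `M`-large in `G`: `m (G \ T) ⊆ T` for all `m ∈ M`. -/
def IsLargeFor (M T : Set G) : Prop := ∀ m ∈ M, ∀ x, x ∉ T → m * x ∈ T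

/-- `S` is a Powers set for `F`: for every `N` there are `h₁, …, h_N ∈ S` and pairwise disjoint
subsets `T₁, …, T_N` of `G` such that `T_j` is `h_j F h_j⁻¹`-large for every `j`. -/
def IsPowersSet (S F : Set G) : Prop :=
  ∀ N : ℕ, ∃ (h : Fin N → G) (T : Fin N → Set G),
    (∀ j, h j ∈ S) ∧ Pairwise (fun i j => Disjoint (T i) (T j)) ∧
      ∀ j, IsLargeFor {x | ∃ f ∈ F, x = h j * f * (h j)⁻¹} (T j)

/-- `S` is a c-Powers set for `g`: it is a Powers set for `⟨g⟩_M` for every finite nonempty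
`M ⊆ S`. -/
def IsCPowersSet (S : Set G) (g : G) : Prop :=
  ∀ M : Set G, M.Finite → M.Nonempty → M ⊆ S → IsPowersSet S (conjugatesBy g M)

variable (G)

/-- `G` is a PH group: every finite nonempty `F ⊆ G \ {e}` can be written as `{f₁, …, f_n}` in such
a way that there are subgroups `G₁ ⊆ ⋯ ⊆ G_n` of `G` with `G_j` a c-Powers set for `f_j`. -/
def IsPHGroup : Prop :=
  ∀ F : Set G, F.Finite → F.Nonempty → (1 : G) ∉ F →
    ∃ (n : ℕ) (f : Fin n → G) (K : Fin n → Subgroup G),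
      Set.range f = F ∧ Monotone K ∧ ∀ j, IsCPowersSet (K j : Set G) (f j)

/-- Property (P_com). -/
def HasPCom : Prop :=
  ∀ F : Set G, F.Finite → F.Nonempty → (1 : G) ∉ F →
    ∃ (n : ℕ) (g₀ : G) (U : Set G) (D : Fin n → Set G),
      (∀ x, x ∉ U → ∃ k, x ∈ D k) ∧
      (∀ g ∈ F, ∀ x ∈ U, g * x ∉ U) ∧
      ∀ j : ℕ, 1 ≤ j → ∀ k, ∀ x ∈ D k, (g₀ ^ j)⁻¹ * x ∉ D k

end GroupNotions

/-! ### Twisted systems and reduced crossed products -/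

/-- A twisted action `(α, σ)` of the discrete group `G` on the unital C*-algebra `A`; together with
`A` and `G` this is a twisted unital discrete C*-dynamical system. -/
structure TwistedAction (A G : Type*) [CStarAlgebra A] [Group G] where
  /-- the automorphisms -/
  α : G → (A ≃⋆ₐ[ℂ] A)
  /-- the cocycle -/
  σ : G → G → unitary A
  α_comp : ∀ g h a, α g (α h a) = (σ g h : A) * α (g * h) a * star (σ g h : A)
  cocycle : ∀ g h k, (σ g h : A) * (σ (g * h) k : A) = α g (σ h k : A) * (σ g (h * k) : A)
  σ_one_right : ∀ g, σ g 1 = 1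
  σ_one_left : ∀ g, σ 1 g = 1

/-- An injective unital *-homomorphism of C*-algebras is isometric. -/
theorem StarAlgHom.norm_map_of_injective {A B : Type*} [CStarAlgebra A] [CStarAlgebra B]
    (φ : A →⋆ₐ[ℂ] B) (hφ : Function.Injective φ) (a : A) : ‖φ a‖ = ‖a‖ := by
  have key : ∀ b : A, IsSelfAdjoint b → ‖b‖ ≤ ‖φ b‖ := by
    intro b hb
    have hcont : Continuous φ :=
      AddMonoidHomClass.continuous_of_bound φ 1
        (fun x => by simpa using NonUnitalStarAlgHom.norm_apply_le φ x)
    have hb' : IsSelfAdjoint (φ b) := hb.map φ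
    let f : ℝ → ℝ := fun x => max (-‖φ b‖) (min x ‖φ b‖)
    have hf : Continuous f := by fun_prop
    have h1 : φ (cfc f b) = φ b := by
      rw [show φ (cfc f b) = cfc f (φ b) from
        StarAlgHomClass.map_cfc (R := ℝ) φ f b hf.continuousOn hcont hb hb']
      conv_rhs => rw [← cfc_id ℝ (φ b) hb']
      refine cfc_congr fun x hx => ?_
      have hle : ‖x‖ ≤ ‖φ b‖ := by
        rcases subsingleton_or_nontrivial B with hB | hB
        · exact absurd hx (by simp [spectrum.of_subsingleton])
        · exact spectrum.norm_le_norm_of_mem hx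
      rw [Real.norm_eq_abs, abs_le] at hle
      simp [f, min_eq_left hle.2, max_eq_right hle.1]
    rw [← hφ h1]
    conv_rhs => rw [h1]
    refine norm_cfc_le (norm_nonneg _) fun x _ => ?_
    rw [Real.norm_eq_abs, abs_le]
    exact ⟨le_max_left _ _, max_le (by linarith [norm_nonneg (φ b)]) (min_le_right _ _)⟩
  refine le_antisymm (NonUnitalStarAlgHom.norm_apply_le φ a) ?_
  have h := key (star a * a) (IsSelfAdjoint.star_mul_self a)
  rw [map_mul, map_star, CStarRing.norm_star_mul_self, CStarRing.norm_star_mul_self] at h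
  exact le_of_sq_le_sq (by simpa [sq] using h) (norm_nonneg _)

namespace TwistedAction

noncomputable section


variable {A G H : Type*} [CStarAlgebra A] [Group G]
  [NormedAddCommGroup H] [InnerProductSpace ℂ H] [CompleteSpace H]

/-- The Hilbert space `ℓ²(G, H)`. -/
abbrev L2 (G H : Type*) [NormedAddCommGroup H] : Type _ := lp (fun _ : G => H) 2

theorem norm_ρ_apply_le (ρ : A →⋆ₐ[ℂ] (H →L[ℂ] H)) (a : A) (v : H) : ‖ρ a v‖ ≤ ‖a‖ * ‖v‖ :=
  ((ρ a).le_opNorm v).trans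
    (mul_le_mul_of_nonneg_right (NonUnitalStarAlgHom.norm_apply_le ρ a) (norm_nonneg v))

theorem summable_sq_norm (ξ : L2 G H) : Summable fun h => ‖ξ h‖ ^ 2 := by
  have := (lp.memℓp ξ).summable (by norm_num)
  simpa using this

theorem sq_norm_eq_tsum (ξ : L2 G H) : ‖ξ‖ ^ 2 = ∑' h, ‖ξ h‖ ^ 2 := by
  have := lp.norm_rpow_eq_tsum (p := 2) (by norm_num) ξ
  simpa using this

theorem sq_norm_weighted_le (ρ : A →⋆ₐ[ℂ] (H →L[ℂ] H)) (F : G → A) (C : ℝ)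
    (hF : ∀ h, ‖F h‖ ≤ C) (e : G ≃ G) (ξ : L2 G H) (h : G) :
    ‖ρ (F h) (ξ (e h))‖ ^ 2 ≤ C ^ 2 * ‖ξ (e h)‖ ^ 2 := by
  rw [← mul_pow]
  refine pow_le_pow_left₀ (norm_nonneg _) ((norm_ρ_apply_le ρ _ _).trans ?_) 2
  exact mul_le_mul_of_nonneg_right (hF h) (norm_nonneg _)

/-- The weighted permutation operator `(T ξ)(h) = ρ (F h) (ξ (e h))` on `ℓ²(G, H)` attached to a
bounded function `F : G → A` and a permutation `e` of `G`. -/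
def weighted (ρ : A →⋆ₐ[ℂ] (H →L[ℂ] H)) (F : G → A) (C : ℝ) (hF : ∀ h, ‖F h‖ ≤ C) (e : G ≃ G) :
    L2 G H →L[ℂ] L2 G H :=
  LinearMap.mkContinuous
    { toFun := fun ξ => ⟨fun h => ρ (F h) (ξ (e h)), memℓp_gen (by
        have hs : Summable fun h => C ^ 2 * ‖ξ (e h)‖ ^ 2 :=
          ((e.summable_iff (f := fun h => ‖ξ h‖ ^ 2)).2 (summable_sq_norm ξ)).mul_left _
        simpa using hs.of_nonneg_of_le (fun h => by positivity)
          (sq_norm_weighted_le ρ F C hF e ξ))⟩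
      map_add' := fun ξ η => by ext h; exact map_add _ _ _
      map_smul' := fun c ξ => by ext h; exact map_smul _ _ _ }
    C (fun ξ => by
      have hC : 0 ≤ C := (norm_nonneg _).trans (hF 1)
      refine le_of_sq_le_sq ?_ (by positivity)
      have hs : Summable fun h => C ^ 2 * ‖ξ (e h)‖ ^ 2 :=
        ((e.summable_iff (f := fun h => ‖ξ h‖ ^ 2)).2 (summable_sq_norm ξ)).mul_left _
      rw [sq_norm_eq_tsum, mul_pow, sq_norm_eq_tsum, ← e.tsum_eq (fun h => ‖ξ h‖ ^ 2),
        ← tsum_mul_left]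
      exact Summable.tsum_le_tsum (sq_norm_weighted_le ρ F C hF e ξ) (summable_sq_norm _) hs)

@[simp]
theorem weighted_apply (ρ : A →⋆ₐ[ℂ] (H →L[ℂ] H)) (F : G → A) (C : ℝ) (hF : ∀ h, ‖F h‖ ≤ C)
    (e : G ≃ G) (ξ : L2 G H) (h : G) : weighted ρ F C hF e ξ h = ρ (F h) (ξ (e h)) := rfl

theorem star_weighted (ρ : A →⋆ₐ[ℂ] (H →L[ℂ] H)) (F : G → A) (C : ℝ) (hF : ∀ h, ‖F h‖ ≤ C)
    (e : G ≃ G) : star (weighted ρ F C hF e) =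
      weighted ρ (fun h => star (F (e.symm h))) C (fun h => by simpa using hF _) e.symm := by
  symm
  rw [ContinuousLinearMap.star_eq_adjoint, ContinuousLinearMap.eq_adjoint_iff]
  intro ξ η
  rw [lp.inner_eq_tsum, lp.inner_eq_tsum, ← e.tsum_eq]
  refine tsum_congr fun h => ?_
  simp only [weighted_apply, e.symm_apply_apply, map_star, ContinuousLinearMap.star_eq_adjoint,
    ContinuousLinearMap.adjoint_inner_left]

variable (S : TwistedAction A G) (ρ : A →⋆ₐ[ℂ] (H →L[ℂ] H))

theorem α_one (a : A) : S.α 1 a = a := by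
  apply (S.α 1).injective
  simpa [S.σ_one_left] using S.α_comp 1 1 a

/-- The operator `(π(a) ξ)(h) = α_{h⁻¹}(a) ξ(h)` on `ℓ²(G, H)`. -/
def piOp (a : A) : L2 G H →L[ℂ] L2 G H :=
  weighted ρ (fun h => S.α h⁻¹ a) ‖a‖ (fun h => (StarAlgEquiv.norm_map (S.α h⁻¹) a).le)
    (Equiv.refl G)

/-- The operator `(λ(g) ξ)(h) = σ(h⁻¹, g) ξ(g⁻¹ h)` on `ℓ²(G, H)`. -/
def lamOp (g : G) : L2 G H →L[ℂ] L2 G H :=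
  weighted ρ (fun h => (S.σ h⁻¹ g : A)) ‖(1 : A)‖
    (fun h => by simpa using (CStarRing.norm_coe_unitary_mul (S.σ h⁻¹ g) (1 : A)).le)
    (Equiv.mulLeft g⁻¹)

@[simp]
theorem piOp_apply (a : A) (ξ : L2 G H) (h : G) : S.piOp ρ a ξ h = ρ (S.α h⁻¹ a) (ξ h) := rfl

@[simp]
theorem lamOp_apply (g : G) (ξ : L2 G H) (h : G) :
    S.lamOp ρ g ξ h = ρ (S.σ h⁻¹ g : A) (ξ (g⁻¹ * h)) := rfl

/-- The regular covariant representation of `A` on `ℓ²(G, H)`. -/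
def piHom : A →⋆ₐ[ℂ] (L2 G H →L[ℂ] L2 G H) where
  toFun := S.piOp ρ
  map_one' := by ext ξ h; simp
  map_mul' a b := by ext ξ h; simp
  map_zero' := by ext ξ h; simp
  map_add' a b := by ext ξ h; simp
  commutes' c := by
    ext ξ h
    simp [Algebra.algebraMap_eq_smul_one]
  map_star' a := by
    rw [piOp, piOp, star_weighted]
    ext ξ h
    simp only [weighted_apply, Equiv.refl_apply, Equiv.refl_symm, map_star]

theorem lamOp_mul (g k : G) :
    S.lamOp ρ g * S.lamOp ρ k = S.piOp ρ (S.σ g k : A) * S.lamOp ρ (g * k) := by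
  ext ξ h
  simp only [mul_apply_eq_comp, lamOp_apply, piOp_apply, mul_inv_rev, inv_inv]
  rw [← mul_apply_eq_comp, ← map_mul, ← mul_apply_eq_comp, ← map_mul,
    S.cocycle, mul_assoc]

theorem lamOp_mul_piOp (g : G) (a : A) :
    S.lamOp ρ g * S.piOp ρ a = S.piOp ρ (S.α g a) * S.lamOp ρ g := by
  ext ξ h
  simp only [mul_apply_eq_comp, lamOp_apply, piOp_apply, mul_inv_rev, inv_inv]
  rw [← mul_apply_eq_comp, ← map_mul, ← mul_apply_eq_comp, ← map_mul,
    S.α_comp, mul_assoc, Unitary.coe_star_mul_self, mul_one]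

theorem lamOp_mem_unitary (g : G) : S.lamOp ρ g ∈ unitary (L2 G H →L[ℂ] L2 G H) := by
  rw [Unitary.mem_iff, lamOp, star_weighted]
  constructor <;> ext ξ h
  · rw [mul_apply_eq_comp, weighted_apply, weighted_apply, ← mul_apply_eq_comp, ← map_mul,
      Unitary.coe_star_mul_self]
    simp
  · rw [mul_apply_eq_comp, weighted_apply, weighted_apply, ← mul_apply_eq_comp, ← map_mul,
      Equiv.symm_apply_apply]
    have hu : (S.σ h⁻¹ g : A) * star (S.σ h⁻¹ g : A) = 1 := Unitary.coe_mul_star_self _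
    rw [hu]
    simp

theorem lamOp_one : S.lamOp ρ 1 = 1 := by
  ext ξ h
  simp [S.σ_one_right]

theorem star_lamOp (g : G) :
    star (S.lamOp ρ g) = S.piOp ρ (star (S.σ g⁻¹ g : A)) * S.lamOp ρ g⁻¹ := by
  have h1 := S.lamOp_mul ρ g⁻¹ g
  rw [inv_mul_cancel, lamOp_one, mul_one] at h1
  have h2 : S.lamOp ρ g⁻¹ = S.piOp ρ (S.σ g⁻¹ g : A) * star (S.lamOp ρ g) := by
    rw [← h1, mul_assoc, (Unitary.mem_iff.1 (S.lamOp_mem_unitary ρ g)).2, mul_one]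
  have h3 : S.piOp ρ (star (S.σ g⁻¹ g : A)) * S.piOp ρ (S.σ g⁻¹ g : A) = 1 := by
    have := (map_mul (S.piHom ρ) (star (S.σ g⁻¹ g : A)) (S.σ g⁻¹ g : A)).symm
    rwa [Unitary.coe_star_mul_self, map_one] at this
  rw [h2, ← mul_assoc, h3, one_mul]

/-- The reduced crossed product `C*_r(Σ)`: the C*-algebra of operators on `ℓ²(G, H)` generated by
the operators `π(a)` and `λ(g)`. It is the reduced crossed product when `ρ` is injective. -/
def redCrossedProduct : StarSubalgebra ℂ (L2 G H →L[ℂ] L2 G H) :=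
  (StarAlgebra.adjoin ℂ (Set.range (S.piOp ρ) ∪ Set.range (S.lamOp ρ))).topologicalClosure

/-- The element `π(a)` of the reduced crossed product. -/
def incl (a : A) : S.redCrossedProduct ρ :=
  ⟨S.piOp ρ a, StarSubalgebra.le_topologicalClosure _
    (StarAlgebra.subset_adjoin ℂ _ (Or.inl ⟨a, rfl⟩))⟩

/-- The unitary `λ(g)` of the reduced crossed product. -/
def lam (g : G) : unitary (S.redCrossedProduct ρ) :=
  ⟨⟨S.lamOp ρ g, StarSubalgebra.le_topologicalClosure _
    (StarAlgebra.subset_adjoin ℂ _ (Or.inr ⟨g, rfl⟩))⟩, by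
    have h := Unitary.mem_iff.1 (S.lamOp_mem_unitary ρ g)
    exact Unitary.mem_iff.2 ⟨Subtype.ext h.1, Subtype.ext h.2⟩⟩

/-- The linear span of the operators `π(a) λ(g)`. -/
def finiteSums : Submodule ℂ (L2 G H →L[ℂ] L2 G H) :=
  Submodule.span ℂ {T | ∃ a g, T = S.piOp ρ a * S.lamOp ρ g}

theorem finiteSums_mul {x y : L2 G H →L[ℂ] L2 G H} (hx : x ∈ S.finiteSums ρ)
    (hy : y ∈ S.finiteSums ρ) : x * y ∈ S.finiteSums ρ := by
  have h := Submodule.mul_mem_mul hx hy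
  rw [finiteSums, Submodule.span_mul_span] at h
  refine Submodule.span_mono ?_ h
  rintro _ ⟨_, ⟨a, g, rfl⟩, _, ⟨b, k, rfl⟩, rfl⟩
  refine ⟨a * S.α g b * (S.σ g k : A), g * k, ?_⟩
  have h1 : ∀ c d, S.piOp ρ (c * d) = S.piOp ρ c * S.piOp ρ d := map_mul (S.piHom ρ)
  simp only [h1]
  rw [mul_assoc, ← mul_assoc (S.lamOp ρ g), lamOp_mul_piOp, mul_assoc (S.piOp ρ _) (S.lamOp ρ g),
    lamOp_mul]
  simp only [mul_assoc]

theorem finiteSums_star {x : L2 G H →L[ℂ] L2 G H} (hx : x ∈ S.finiteSums ρ) :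
    star x ∈ S.finiteSums ρ := by
  induction hx using Submodule.span_induction with
  | mem x hx =>
    obtain ⟨a, g, rfl⟩ := hx
    have h1 : star (S.piOp ρ a) = S.piOp ρ (star a) := (map_star (S.piHom ρ) a).symm
    rw [star_mul, star_lamOp, h1]
    refine S.finiteSums_mul ρ (Submodule.subset_span ⟨_, _, rfl⟩)
      (Submodule.subset_span ⟨star a, 1, ?_⟩)
    rw [lamOp_one, mul_one]
  | zero => simp
  | add x y _ _ hx hy => rw [star_add]; exact add_mem hx hy
  | smul c x _ hx => rw [star_smul]; exact Submodule.smul_mem _ _ hx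

theorem adjoin_subset_finiteSums {x : L2 G H →L[ℂ] L2 G H}
    (hx : x ∈ StarAlgebra.adjoin ℂ (Set.range (S.piOp ρ) ∪ Set.range (S.lamOp ρ))) :
    x ∈ S.finiteSums ρ := by
  have hπ : ∀ a, S.piOp ρ a ∈ S.finiteSums ρ := fun a =>
    Submodule.subset_span ⟨a, 1, by rw [lamOp_one, mul_one]⟩
  have h1 : S.piOp ρ 1 = 1 := map_one (S.piHom ρ)
  induction hx using StarAlgebra.adjoin_induction with
  | mem x hx =>
    rcases hx with ⟨a, rfl⟩ | ⟨g, rfl⟩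
    · exact hπ a
    · exact Submodule.subset_span ⟨1, g, by rw [h1, one_mul]⟩
  | algebraMap r =>
    rw [Algebra.algebraMap_eq_smul_one, ← h1]
    exact Submodule.smul_mem _ _ (hπ 1)
  | add x y _ _ hx hy => exact add_mem hx hy
  | mul x y _ _ hx hy => exact S.finiteSums_mul ρ hx hy
  | star x _ hx => exact S.finiteSums_star ρ hx

open Classical in
/-- The compression `T ↦ V* T V` of operators on `ℓ²(G, H)` to the copy `V : H → ℓ²(G, H)` of `H`
that sits at the identity of `G`. -/
def compress (G H : Type*) [Group G] [NormedAddCommGroup H] [InnerProductSpace ℂ H] :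
    (L2 G H →L[ℂ] L2 G H) →ₗ[ℂ] (H →L[ℂ] H) where
  toFun T := (lp.evalCLM ℂ (fun _ : G => H) 2 1).comp
    (T.comp (lp.singleContinuousLinearMap ℂ (fun _ : G => H) 2 1))
  map_add' T T' := by ext v; simp
  map_smul' c T := by ext v; simp

theorem continuous_compress : Continuous (compress G H) := by
  change Continuous fun T => _
  simp only [compress, LinearMap.coe_mk, AddHom.coe_mk]
  fun_prop

theorem compress_piOp_mul_lamOp (a : A) (g : G) [Decidable (g = 1)] :
    compress G H (S.piOp ρ a * S.lamOp ρ g) = ρ (if g = 1 then a else 0) := by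
  classical
  ext v
  change S.piOp ρ a (S.lamOp ρ g (lp.single 2 1 v)) 1 = _
  rw [piOp_apply, lamOp_apply, lp.single_apply]
  by_cases hg : g = 1
  · subst hg
    simp [S.σ_one_left, S.α_one]
  · simp [hg]

theorem compress_mem_range (hρ : Function.Injective ρ) (x : S.redCrossedProduct ρ) :
    compress G H (x : L2 G H →L[ℂ] L2 G H) ∈ LinearMap.range ρ.toAlgHom.toLinearMap := by
  classical
  have hcl : IsClosed (LinearMap.range ρ.toAlgHom.toLinearMap : Set (H →L[ℂ] H)) := by
    have hiso : Isometry ρ :=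
      AddMonoidHomClass.isometry_of_norm ρ (StarAlgHom.norm_map_of_injective ρ hρ)
    exact hiso.isClosedEmbedding.isClosed_range
  have hx : (x : L2 G H →L[ℂ] L2 G H) ∈ closure
      (StarAlgebra.adjoin ℂ (Set.range (S.piOp ρ) ∪ Set.range (S.lamOp ρ)) :
        Set (L2 G H →L[ℂ] L2 G H)) := x.2
  refine closure_minimal (t := compress G H ⁻¹' _) ?_ (hcl.preimage continuous_compress) hx
  intro y hy
  have hy' := S.adjoin_subset_finiteSums ρ hy
  change compress G H y ∈ LinearMap.range ρ.toAlgHom.toLinearMap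
  clear hy
  induction hy' using Submodule.span_induction with
  | mem y hy =>
    obtain ⟨a, g, rfl⟩ := hy
    rw [compress_piOp_mul_lamOp]
    exact ⟨_, rfl⟩
  | zero => simp
  | add y z _ _ hy hz => rw [map_add]; exact add_mem hy hz
  | smul c y _ hy => rw [map_smul]; exact Submodule.smul_mem _ _ hy

/-- The canonical conditional expectation `E : C*_r(Σ) → A`: `E x` is the unique element of `A`
whose image under `ρ` is the compression of `x` to the copy of `H` at the identity of `G`. -/
def condExp (hρ : Function.Injective ρ) : S.redCrossedProduct ρ →ₗ[ℂ] A :=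
  (LinearEquiv.ofInjective ρ.toAlgHom.toLinearMap hρ).symm.toLinearMap ∘ₗ
    ((compress G H).comp (S.redCrossedProduct ρ).toSubalgebra.toSubmodule.subtype).codRestrict
      (LinearMap.range ρ.toAlgHom.toLinearMap) (S.compress_mem_range ρ hρ)

theorem ρ_condExp (hρ : Function.Injective ρ) (x : S.redCrossedProduct ρ) :
    ρ (S.condExp ρ hρ x) = compress G H (x : L2 G H →L[ℂ] L2 G H) :=
  congrArg Subtype.val ((LinearEquiv.ofInjective ρ.toAlgHom.toLinearMap hρ).apply_symm_apply
    ⟨_, S.compress_mem_range ρ hρ x⟩)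

/-- `E (π(a) λ(g))` is `a` if `g` is the identity and `0` otherwise. -/
theorem condExp_incl_mul_lam (hρ : Function.Injective ρ) (a : A) (g : G) [Decidable (g = 1)] :
    S.condExp ρ hρ (S.incl ρ a * (S.lam ρ g : S.redCrossedProduct ρ)) = if g = 1 then a else 0 := by
  apply hρ
  rw [ρ_condExp, ← compress_piOp_mul_lamOp S]
  rfl

/-- The subgroup `U_G` of the unitary group of `C*_r(Σ)` generated by the unitaries `λ(g)`. -/
def lamGroup : Subgroup (unitary (S.redCrossedProduct ρ)) :=
  Subgroup.closure (Set.range (S.lam ρ))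

/-- Property (DP). -/
def HasDP (hρ : Function.Injective ρ) : Prop :=
  ∀ y : S.redCrossedProduct ρ, star y = y → S.condExp ρ hρ y = 0 →
    (0 : S.redCrossedProduct ρ) ∈ closure (convexHull ℝ
      {x | ∃ v : unitary (S.redCrossedProduct ρ),
        x = (v : S.redCrossedProduct ρ) * y * star (v : S.redCrossedProduct ρ)})

/-- The strong form of property (DP): only unitaries in `U_G` are used. -/
def HasStrongDP (hρ : Function.Injective ρ) : Prop :=
  ∀ y : S.redCrossedProduct ρ, star y = y → S.condExp ρ hρ y = 0 →
    (0 : S.redCrossedProduct ρ) ∈ closure (convexHull ℝ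
      {x | ∃ v ∈ S.lamGroup ρ,
        x = (v : S.redCrossedProduct ρ) * y * star (v : S.redCrossedProduct ρ)})

end

end TwistedAction

/-!
Averaging `x` over conjugations by unitaries never increases its norm, so it suffices to average
finite sums `∑ π(a_g) λ(g)` over `g ∈ F`, `e ∉ F`, down to small norm: these are dense in the kernel
of `E`, because `x ↦ x - E x` is continuous and maps finite sums to such sums.

Let `P` be the coordinate projection of `ℓ²(G, H)` onto an `h F h⁻¹`-large set `T`. Conjugating `x`
by `λ(h)` gives an element supported on `h F h⁻¹`, whose corner at `1 - P` vanishes. If the sets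
`T₁, …, T_N` cover every point at most `K` times, Cauchy–Schwarz bounds the sum of the `N`
conjugates by `2 ‖x‖ √(N K)`, and their average by `2 ‖x‖ √(K / N)`. Under (P_com) one takes
`h_j = g₀ ^ j` and for `T_j` the translate by `g₀ ^ j` of the complement of `U`; then `K` is the
number of sets `D_k`.

In a PH group the components of `x` at `f₁, …, f_n` are averaged in this order. Averaging over
`G₁` replaces the component at `f_j` by an element supported on the conjugates of `f_j` by finitely
many elements of `G₁ ⊆ G_j`, for which `G_j` is still a Powers set, and later averages do not
increase what has already been made small.
-/

section SumEstimate

variable {𝕜 E ι : Type*} [NormedAddCommGroup E] [Fintype ι]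

theorem norm_sum_mul_le_mul_sqrt [NontriviallyNormedField 𝕜] [NormedSpace 𝕜 E]
    {x P : ι → E →L[𝕜] E} {C K : ℝ} (hx : ∀ j, ‖x j‖ ≤ C)
    (hP : ∀ ξ, ∑ j, ‖P j ξ‖ ^ 2 ≤ K * ‖ξ‖ ^ 2) :
    ‖∑ j, x j * P j‖ ≤ C * √(Fintype.card ι * K) := by
  rcases isEmpty_or_nonempty ι with hι | ⟨⟨i⟩⟩
  · simp
  have hC : 0 ≤ C := (norm_nonneg _).trans (hx i)
  have hsum (ξ : E) : ∑ j, ‖P j ξ‖ ≤ √(Fintype.card ι * K) * ‖ξ‖ := by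
    rw [← Real.sqrt_sq (norm_nonneg ξ), ← Real.sqrt_mul' _ (sq_nonneg _), mul_assoc]
    refine Real.le_sqrt_of_sq_le (sq_sum_le_card_mul_sum_sq.trans ?_)
    exact mul_le_mul_of_nonneg_left (hP ξ) (Nat.cast_nonneg _)
  refine ContinuousLinearMap.opNorm_le_bound _ (by positivity) fun ξ => ?_
  calc ‖(∑ j, x j * P j) ξ‖ = ‖∑ j, x j (P j ξ)‖ := by simp
    _ ≤ ∑ j, C * ‖P j ξ‖ := norm_sum_le_of_le _ fun j _ => (x j).le_of_opNorm_le (hx j) _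
    _ ≤ C * √(Fintype.card ι * K) * ‖ξ‖ := by
      rw [← Finset.mul_sum, mul_assoc]
      exact mul_le_mul_of_nonneg_left (hsum ξ) hC

theorem norm_sum_le_of_corner_eq_zero [RCLike 𝕜] [InnerProductSpace 𝕜 E] [CompleteSpace E]
    {x P : ι → E →L[𝕜] E} {C K : ℝ} (hx : ∀ j, ‖x j‖ ≤ C) (hP : ∀ j, IsStarProjection (P j))
    (hK : ∀ ξ, ∑ j, ‖P j ξ‖ ^ 2 ≤ K * ‖ξ‖ ^ 2)
    (hcorner : ∀ j, (1 - P j) * x j * (1 - P j) = 0) :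
    ‖∑ j, x j‖ ≤ 2 * C * √(Fintype.card ι * K) := by
  have hsplit (j : ι) : x j = P j * x j + (1 - P j) * x j * P j := by
    linear_combination (norm := noncomm_ring) hcorner j
  have hrow : ‖∑ j, P j * x j‖ ≤ C * √(Fintype.card ι * K) := by
    rw [← norm_star, star_sum]
    simp only [star_mul, (hP _).isSelfAdjoint.star_eq]
    exact norm_sum_mul_le_mul_sqrt (fun j => (norm_star (x j)).trans_le (hx j)) hK
  have hcompl (j : ι) : ‖(1 - P j) * x j‖ ≤ C :=
    (norm_mul_le_of_le (IsStarProjection.norm_le _ (hP j).one_sub) (hx j)).trans_eq (one_mul C)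
  calc ‖∑ j, x j‖ = ‖∑ j, P j * x j + ∑ j, (1 - P j) * x j * P j‖ := by
        rw [← Finset.sum_add_distrib, ← Finset.sum_congr rfl fun j _ => hsplit j]
    _ ≤ C * √(Fintype.card ι * K) + C * √(Fintype.card ι * K) :=
      norm_add_le_of_le hrow (norm_sum_mul_le_mul_sqrt hcompl hK)
    _ = 2 * C * √(Fintype.card ι * K) := by ring

end SumEstimate

section CoordProj

variable {𝕜 ι E : Type*} [NontriviallyNormedField 𝕜] [NormedAddCommGroup E] [NormedSpace 𝕜 E]

variable (𝕜) in
/-- The coordinate projection of `ℓ²(ι, E)` onto the vectors supported on `T`. -/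
noncomputable def coordProj (T : Set ι) : lp (fun _ : ι => E) 2 →L[𝕜] lp (fun _ : ι => E) 2 :=
  have hle (ξ : ι → E) (t : ι) : ‖T.indicator ξ t‖ ≤ ‖ξ t‖ := norm_indicator_le_norm_self ξ t
  LinearMap.mkContinuous
    { toFun := fun ξ => ⟨T.indicator ξ, (lp.memℓp ξ).mono' (hle ξ)⟩
      map_add' := fun ξ η => by ext t; exact congrFun (Set.indicator_add T ξ η) t
      map_smul' := fun c ξ => by ext t; exact congrFun (Set.indicator_const_smul T c ξ) t }
    1 fun ξ => by simpa using lp.norm_mono two_ne_zero (hle ξ)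

@[simp]
theorem coe_coordProj_apply (T : Set ι) (ξ : lp (fun _ : ι => E) 2) :
    ⇑(coordProj 𝕜 T ξ) = T.indicator ξ := rfl

theorem coordProj_compl (T : Set ι) :
    (coordProj 𝕜 Tᶜ : lp (fun _ : ι => E) 2 →L[𝕜] lp (fun _ : ι => E) 2) = 1 - coordProj 𝕜 T := by
  ext ξ t
  exact congrFun (Set.indicator_compl T ξ) t

theorem sum_sq_norm_coordProj_le {κ : Type*} [Fintype κ] {T : κ → Set ι} {K : ℕ}
    (hT : ∀ t, {j | t ∈ T j}.ncard ≤ K) (ξ : lp (fun _ : ι => E) 2) :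
    ∑ j, ‖coordProj 𝕜 (T j) ξ‖ ^ 2 ≤ K * ‖ξ‖ ^ 2 := by
  classical
  have hnorm (η : lp (fun _ : ι => E) 2) : HasSum (fun t => ‖η t‖ ^ 2) (‖η‖ ^ 2) := by
    simpa using lp.hasSum_norm (p := 2) (by norm_num) η
  have hpoint (t : ι) : ∑ j, ‖coordProj 𝕜 (T j) ξ t‖ ^ 2 = {j | t ∈ T j}.ncard * ‖ξ t‖ ^ 2 := by
    simp [Set.indicator_apply, apply_ite norm, ite_pow, Set.ncard_eq_toFinset_card',
      ← Finset.sum_filter]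
  refine hasSum_le (fun t => ?_) (hasSum_sum fun j _ => hnorm (coordProj 𝕜 (T j) ξ))
    ((hnorm ξ).mul_left (K : ℝ))
  rw [hpoint]
  gcongr
  exact hT t

end CoordProj

theorem isStarProjection_coordProj {𝕜 ι E : Type*} [RCLike 𝕜] [NormedAddCommGroup E]
    [InnerProductSpace 𝕜 E] [CompleteSpace E] (T : Set ι) :
    IsStarProjection (coordProj 𝕜 T : lp (fun _ : ι => E) 2 →L[𝕜] lp (fun _ : ι => E) 2) where
  isIdempotentElem := by
    ext ξ t
    simp [Set.indicator_indicator]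
  isSelfAdjoint := by
    rw [ContinuousLinearMap.isSelfAdjoint_iff_isSymmetric]
    intro ξ η
    simp only [ContinuousLinearMap.coe_coe, lp.inner_eq_tsum, coe_coordProj_apply]
    refine tsum_congr fun t => ?_
    by_cases ht : t ∈ T <;> simp [ht]

section ConjOrbit

variable {M : Type*} [Monoid M] [StarMul M]

/-- The orbit of `y` under conjugation by the unitaries in `U`. -/
def conjOrbit (U : Subgroup (unitary M)) (y : M) : Set M :=
  {x | ∃ v ∈ U, x = (v : M) * y * star (v : M)}

theorem mul_mul_star_mem_conjOrbit {U : Subgroup (unitary M)} {u : unitary M} (hu : u ∈ U)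
    {x y : M} (hx : x ∈ conjOrbit U y) : (u : M) * x * star (u : M) ∈ conjOrbit U y := by
  obtain ⟨v, hv, rfl⟩ := hx
  exact ⟨u * v, mul_mem hu hv, by simp [mul_assoc]⟩

end ConjOrbit

theorem norm_mul_mul_star_unitary {B : Type*} [NormedRing B] [StarRing B] [CStarRing B]
    (u : unitary B) (x : B) : ‖(u : B) * x * star (u : B)‖ = ‖x‖ := by
  rw [← Unitary.coe_star, CStarRing.norm_mul_coe_unitary, CStarRing.norm_coe_unitary_mul]

section ConjAveraging

variable {B : Type*} [Ring B] [StarMul B] [Algebra ℝ B]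

/-- A linear map that sends every element into the convex hull of its orbit under conjugation by
the unitaries in `U`. -/
def IsConjAveraging (U : Subgroup (unitary B)) (Φ : B →ₗ[ℝ] B) : Prop :=
  ∀ y, Φ y ∈ convexHull ℝ (conjOrbit U y)

variable {U : Subgroup (unitary B)} {Φ Ψ : B →ₗ[ℝ] B}

theorem isConjAveraging_id : IsConjAveraging U LinearMap.id := fun _ =>
  subset_convexHull ℝ _ ⟨1, one_mem U, by simp⟩

theorem IsConjAveraging.comp (hΦ : IsConjAveraging U Φ) (hΨ : IsConjAveraging U Ψ) :
    IsConjAveraging U (Φ ∘ₗ Ψ) := by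
  intro y
  refine convexHull_min ?_ (convex_convexHull ℝ _) (hΦ (Ψ y))
  rintro _ ⟨v, hv, rfl⟩
  let conj : B →ₗ[ℝ] B := LinearMap.mulLeftRight ℝ ((v : B), star (v : B))
  have himage : conj '' conjOrbit U y ⊆ conjOrbit U y :=
    Set.image_subset_iff.2 fun _ => mul_mul_star_mem_conjOrbit hv
  have hmem : conj (Ψ y) ∈ conj '' convexHull ℝ (conjOrbit U y) := Set.mem_image_of_mem _ (hΨ y)
  rw [LinearMap.image_convexHull] at hmem
  exact convexHull_mono himage hmem

/-- The average of the conjugations by the unitaries `u j`; it is `0` if there are none. -/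
noncomputable def conjAverage {ι : Type*} [Fintype ι] (u : ι → unitary B) : B →ₗ[ℝ] B :=
  (Fintype.card ι : ℝ)⁻¹ • ∑ j, LinearMap.mulLeftRight ℝ ((u j : B), star (u j : B))

theorem conjAverage_apply {ι : Type*} [Fintype ι] (u : ι → unitary B) (x : B) :
    conjAverage u x = (Fintype.card ι : ℝ)⁻¹ • ∑ j, (u j : B) * x * star (u j : B) := by
  simp [conjAverage]

theorem isConjAveraging_conjAverage {ι : Type*} [Fintype ι] [Nonempty ι] {u : ι → unitary B}
    (hu : ∀ j, u j ∈ U) : IsConjAveraging U (conjAverage u) := by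
  intro y
  rw [conjAverage_apply, Finset.smul_sum]
  exact (convex_convexHull ℝ _).sum_mem (fun _ _ => by positivity) (by simp)
    fun j _ => subset_convexHull ℝ _ ⟨u j, hu j, rfl⟩

end ConjAveraging

section NormConjAveraging

variable {B : Type*} [NormedRing B] [StarRing B] [CStarRing B] [NormedAlgebra ℝ B]
  {U : Subgroup (unitary B)}

theorem IsConjAveraging.norm_apply_le {Φ : B →ₗ[ℝ] B} (hΦ : IsConjAveraging U Φ) (y : B) :
    ‖Φ y‖ ≤ ‖y‖ := by
  have hball : convexHull ℝ (conjOrbit U y) ⊆ Metric.closedBall 0 ‖y‖ := by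
    refine convexHull_min ?_ (convex_closedBall _ _)
    rintro _ ⟨v, -, rfl⟩
    exact mem_closedBall_zero_iff.2 (norm_mul_mul_star_unitary v y).le
  exact mem_closedBall_zero_iff.1 (hball (hΦ y))

theorem zero_mem_closure_convexHull_conjOrbit {s : Set B}
    (hs : ∀ z ∈ s, ∀ ε > 0, ∃ Φ, IsConjAveraging U Φ ∧ ‖Φ z‖ ≤ ε) {y : B} (hy : y ∈ closure s) :
    0 ∈ closure (convexHull ℝ (conjOrbit U y)) := by
  refine Metric.mem_closure_iff.2 fun ε hε => ?_
  obtain ⟨z, hz, hyz⟩ := Metric.mem_closure_iff.1 hy (ε / 2) (half_pos hε)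
  obtain ⟨Φ, hΦ, hΦz⟩ := hs z hz (ε / 2) (half_pos hε)
  refine ⟨Φ y, hΦ y, ?_⟩
  calc dist 0 (Φ y) = ‖Φ (y - z) + Φ z‖ := by rw [dist_zero_left, ← map_add, sub_add_cancel]
    _ ≤ ‖Φ (y - z)‖ + ‖Φ z‖ := norm_add_le _ _
    _ < ε / 2 + ε / 2 :=
      add_lt_add_of_lt_of_le ((hΦ.norm_apply_le _).trans_lt (dist_eq_norm y z ▸ hyz)) hΦz
    _ = ε := add_halves ε

end NormConjAveraging

section PowersSets

variable {G : Type*} [Group G]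

/-- `X` is a Powers set for `F`, except that a point may lie in up to `K` of the sets
`T₁, …, T_N`. Both Powers sets and property (P_com) provide such sets. -/
def IsPowersSetOfMultiplicity (K : ℕ) (X F : Set G) : Prop :=
  ∀ N : ℕ, ∃ (h : Fin N → G) (T : Fin N → Set G),
    (∀ j, h j ∈ X) ∧ (∀ t, {j | t ∈ T j}.ncard ≤ K) ∧
      ∀ j, IsLargeFor {x | ∃ f ∈ F, x = h j * f * (h j)⁻¹} (T j)

theorem IsPowersSet.isPowersSetOfMultiplicity_one {X F : Set G} (hX : IsPowersSet X F) :
    IsPowersSetOfMultiplicity 1 X F := by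
  intro N
  obtain ⟨h, T, hhX, hdisj, hlarge⟩ := hX N
  refine ⟨h, T, hhX, fun t => (Set.ncard_le_one_iff).2 fun {i j} hi hj => ?_, hlarge⟩
  by_contra hij
  exact Set.disjoint_left.1 (hdisj hij) hi hj

theorem ncard_inv_pow_mul_notMem_le {g₀ : G} {U : Set G} {n : ℕ} {D : Fin n → Set G}
    (hUD : ∀ x, x ∉ U → ∃ k, x ∈ D k)
    (hD : ∀ j : ℕ, 1 ≤ j → ∀ k, ∀ x ∈ D k, (g₀ ^ j)⁻¹ * x ∉ D k) (N : ℕ) (t : G) :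
    {j : Fin N | (g₀ ^ (j : ℕ))⁻¹ * t ∉ U}.ncard ≤ n := by
  classical
  have hne {k : Fin n} {i j : ℕ} (hi : (g₀ ^ i)⁻¹ * t ∈ D k) (hj : (g₀ ^ j)⁻¹ * t ∈ D k) :
      ¬ i < j := fun hij => by
    refine hD (j - i) (by omega) k _ hi ?_
    rwa [← mul_assoc, ← mul_inv_rev, ← pow_add, Nat.add_sub_cancel' hij.le]
  rw [Set.ncard_eq_toFinset_card']
  refine (Finset.card_le_card_of_forall_subsingleton
    (fun (j : Fin N) k => (g₀ ^ (j : ℕ))⁻¹ * t ∈ D k) (t := Finset.univ) (fun j hj => ?_)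
    fun k _ i hi j hj => ?_).trans_eq (Finset.card_fin n)
  · simpa using hUD _ (Set.mem_toFinset.1 hj)
  · exact Fin.ext ((not_lt.1 (hne hj.2 hi.2)).antisymm (not_lt.1 (hne hi.2 hj.2)))

theorem HasPCom.exists_isPowersSetOfMultiplicity (hG : HasPCom G) {F : Set G} (hF : F.Finite)
    (hne : F.Nonempty) (h1 : 1 ∉ F) : ∃ K, IsPowersSetOfMultiplicity K Set.univ F := by
  obtain ⟨n, g₀, U, D, hUD, hU, hD⟩ := hG F hF hne h1
  refine ⟨n, fun N => ⟨fun j => g₀ ^ (j : ℕ), fun j => {t | (g₀ ^ (j : ℕ))⁻¹ * t ∉ U},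
    fun _ => Set.mem_univ _, ncard_inv_pow_mul_notMem_le hUD hD N, ?_⟩⟩
  rintro j _ ⟨f, hf, rfl⟩ t ht
  have hmem : (g₀ ^ (j : ℕ))⁻¹ * t ∈ U := not_not.1 ht
  simpa [mul_assoc] using hU f hf _ hmem

theorem conjugatesBy_singleton_one (g : G) : conjugatesBy g {1} = {g} := by
  ext x
  simp [conjugatesBy]

end PowersSets

namespace TwistedAction

variable {A G H : Type*} [CStarAlgebra A] [Group G]
  [NormedAddCommGroup H] [InnerProductSpace ℂ H] [CompleteSpace H]
  (S : TwistedAction A G) (ρ : A →⋆ₐ[ℂ] (H →L[ℂ] H))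

/-- The embedding `incl` of `A` into its reduced crossed product, as a *-homomorphism. -/
noncomputable def inclHom : A →⋆ₐ[ℂ] S.redCrossedProduct ρ :=
  (S.piHom ρ).codRestrict (S.redCrossedProduct ρ) fun a => (S.incl ρ a).2

theorem continuous_incl : Continuous (S.incl ρ) :=
  AddMonoidHomClass.continuous_of_bound (S.inclHom ρ) 1 fun a =>
    (NonUnitalStarAlgHom.norm_apply_le (S.piHom ρ) a).trans_eq (one_mul _).symm

theorem lam_one : S.lam ρ 1 = 1 := Subtype.ext (Subtype.ext (S.lamOp_one ρ))

theorem lam_mul_lam (g k : G) : (S.lam ρ g * S.lam ρ k : S.redCrossedProduct ρ) =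
    S.incl ρ (S.σ g k) * S.lam ρ (g * k) :=
  Subtype.ext (S.lamOp_mul ρ g k)

theorem lam_mul_incl (g : G) (a : A) : (S.lam ρ g : S.redCrossedProduct ρ) * S.incl ρ a =
    S.incl ρ (S.α g a) * S.lam ρ g :=
  Subtype.ext (S.lamOp_mul_piOp ρ g a)

theorem lam_conj_incl_mul_lam (s : G) (a : A) (g : G) :
    (S.lam ρ s : S.redCrossedProduct ρ) * (S.incl ρ a * S.lam ρ g) *
      star (S.lam ρ s : S.redCrossedProduct ρ) =
      S.incl ρ (S.α s a * S.σ s g * star (S.σ (s * g * s⁻¹) s : A)) * S.lam ρ (s * g * s⁻¹) := by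
  have hmul (b c : A) : S.incl ρ (b * c) = S.incl ρ b * S.incl ρ c := map_mul (S.inclHom ρ) b c
  have hright : (S.lam ρ s : S.redCrossedProduct ρ) * (S.incl ρ a * S.lam ρ g) =
      S.incl ρ (S.α s a * S.σ s g * star (S.σ (s * g * s⁻¹) s : A)) * S.lam ρ (s * g * s⁻¹) *
        S.lam ρ s := by
    rw [mul_assoc (S.incl ρ _), lam_mul_lam, inv_mul_cancel_right, ← mul_assoc (S.incl ρ _),
      ← hmul, mul_assoc _ _ (S.σ (s * g * s⁻¹) s : A), Unitary.coe_star_mul_self, mul_one,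
      ← mul_assoc, lam_mul_incl, mul_assoc, lam_mul_lam, ← mul_assoc, ← hmul]
  rw [hright, mul_assoc, Unitary.mul_star_self_of_mem (S.lam ρ s).2, mul_one]

/-- The linear span of the elements `π(a) λ(g)` with `g ∈ F`. -/
noncomputable def supportedOn (F : Set G) : Submodule ℂ (S.redCrossedProduct ρ) :=
  Submodule.span ℂ {x | ∃ a, ∃ g ∈ F, x = S.incl ρ a * S.lam ρ g}

variable {S ρ}

theorem incl_mul_lam_apply (a : A) (g : G) (ξ : L2 G H) (t : G) :
    ((S.incl ρ a * S.lam ρ g : S.redCrossedProduct ρ) : L2 G H →L[ℂ] L2 G H) ξ t =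
      ρ (S.α t⁻¹ a) (ρ (S.σ t⁻¹ g : A) (ξ (g⁻¹ * t))) := rfl

theorem incl_mul_lam_mem_supportedOn {F : Set G} (a : A) {g : G} (hg : g ∈ F) :
    S.incl ρ a * S.lam ρ g ∈ S.supportedOn ρ F :=
  Submodule.subset_span ⟨a, g, hg, rfl⟩

theorem supportedOn_mono {F F' : Set G} (h : F ⊆ F') : S.supportedOn ρ F ≤ S.supportedOn ρ F' :=
  Submodule.span_mono fun _ ⟨a, g, hg, hx⟩ => ⟨a, g, h hg, hx⟩

theorem supportedOn_iUnion {ι : Type*} (F : ι → Set G) :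
    S.supportedOn ρ (⋃ i, F i) = ⨆ i, S.supportedOn ρ (F i) := by
  simp only [supportedOn, ← Submodule.span_iUnion]
  congr 1
  ext x
  simp only [Set.mem_iUnion, Set.mem_ofPred_eq]
  tauto

theorem lam_conj_mem_supportedOn {F F' : Set G} {s : G} (h : ∀ g ∈ F, s * g * s⁻¹ ∈ F')
    {x : S.redCrossedProduct ρ} (hx : x ∈ S.supportedOn ρ F) :
    (S.lam ρ s : S.redCrossedProduct ρ) * x * star (S.lam ρ s : S.redCrossedProduct ρ) ∈
      S.supportedOn ρ F' := by
  suffices hle : S.supportedOn ρ F ≤ (S.supportedOn ρ F').comap (LinearMap.mulLeftRight ℂ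
      ((S.lam ρ s : S.redCrossedProduct ρ), star (S.lam ρ s : S.redCrossedProduct ρ))) from hle hx
  refine Submodule.span_le.2 ?_
  rintro _ ⟨a, g, hg, rfl⟩
  rw [SetLike.mem_coe, Submodule.mem_comap, LinearMap.mulLeftRight_apply,
    lam_conj_incl_mul_lam]
  exact incl_mul_lam_mem_supportedOn _ (h g hg)

theorem coordProj_compl_mul_mul_coordProj_compl {F T : Set G} (hT : IsLargeFor F T)
    {x : S.redCrossedProduct ρ} (hx : x ∈ S.supportedOn ρ F) :
    coordProj ℂ Tᶜ * (x : L2 G H →L[ℂ] L2 G H) * coordProj ℂ Tᶜ = (0 : L2 G H →L[ℂ] L2 G H) := by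
  induction hx using Submodule.span_induction with
  | mem x hx =>
    obtain ⟨a, g, hg, rfl⟩ := hx
    ext ξ t
    simp only [mul_apply_eq_comp, coe_coordProj_apply, incl_mul_lam_apply,
      zero_apply, lp.coeFn_zero, Pi.zero_apply, Set.indicator_apply_eq_zero]
    intro ht
    have hgt : g⁻¹ * t ∉ Tᶜ := fun h => ht (by simpa using hT g hg _ h)
    rw [Set.indicator_of_notMem hgt, map_zero, map_zero]
  | zero => simp
  | add x y _ _ hx hy => rw [AddMemClass.coe_add, mul_add, add_mul, hx, hy, add_zero]
  | smul c x _ hx => rw [SetLike.val_smul, mul_smul_comm, smul_mul_assoc, hx, smul_zero]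

theorem norm_sum_le_of_mem_supportedOn {ι : Type*} [Fintype ι] {x : ι → S.redCrossedProduct ρ}
    {F T : ι → Set G} {C : ℝ} {K : ℕ} (hx : ∀ j, x j ∈ S.supportedOn ρ (F j))
    (hC : ∀ j, ‖x j‖ ≤ C) (hT : ∀ j, IsLargeFor (F j) (T j))
    (hK : ∀ t, {j | t ∈ T j}.ncard ≤ K) : ‖∑ j, x j‖ ≤ 2 * C * √(Fintype.card ι * K) := by
  have hcorner (j : ι) := coordProj_compl_mul_mul_coordProj_compl (hT j) (hx j)
  simp only [coordProj_compl] at hcorner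
  have hcoe : (S.redCrossedProduct ρ).subtype (∑ j, x j) =
      ∑ j, (S.redCrossedProduct ρ).subtype (x j) := map_sum _ _ _
  refine (congrArg norm hcoe).trans_le ?_
  exact norm_sum_le_of_corner_eq_zero hC (fun j => isStarProjection_coordProj (T j))
    (sum_sq_norm_coordProj_le hK) hcorner

theorem norm_conjAverage_lam_le {ι : Type*} [Fintype ι] {h : ι → G} {F : Set G} {T : ι → Set G}
    {K : ℕ} (hT : ∀ j, IsLargeFor {x | ∃ f ∈ F, x = h j * f * (h j)⁻¹} (T j))
    (hK : ∀ t, {j | t ∈ T j}.ncard ≤ K) {x : S.redCrossedProduct ρ}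
    (hx : x ∈ S.supportedOn ρ F) :
    ‖conjAverage (fun j => S.lam ρ (h j)) x‖ ≤ 2 * ‖x‖ * √(K / Fintype.card ι) := by
  have hsum := norm_sum_le_of_mem_supportedOn
    (F := fun j => {x | ∃ f ∈ F, x = h j * f * (h j)⁻¹})
    (fun j => lam_conj_mem_supportedOn (fun f hf => by exact ⟨f, hf, rfl⟩) hx)
    (fun j => (norm_mul_mul_star_unitary (S.lam ρ (h j)) x).le) hT hK
  rw [conjAverage_apply, norm_smul, norm_inv, RCLike.norm_natCast]
  refine (mul_le_mul_of_nonneg_left hsum (by positivity)).trans_eq ?_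
  rcases isEmpty_or_nonempty ι with hι | hι
  · simp
  · have hcard : (0 : ℝ) < Fintype.card ι := by exact_mod_cast Fintype.card_pos
    have hsqrt : √(Fintype.card ι * K) = Fintype.card ι * √(K / Fintype.card ι) := by
      rw [← Real.sqrt_sq hcard.le, ← Real.sqrt_mul (sq_nonneg _), Real.sqrt_sq hcard.le]
      congr 1
      field_simp
    rw [hsqrt]
    field_simp

theorem isConjAveraging_conjAverage_lam {ι : Type*} [Fintype ι] [Nonempty ι] (h : ι → G) :
    IsConjAveraging (S.lamGroup ρ) (conjAverage fun j => S.lam ρ (h j)) :=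
  isConjAveraging_conjAverage fun j => Subgroup.subset_closure ⟨h j, rfl⟩

theorem exists_norm_conjAverage_lam_le {K : ℕ} {X F : Set G}
    (hX : IsPowersSetOfMultiplicity K X F) {x : S.redCrossedProduct ρ}
    (hx : x ∈ S.supportedOn ρ F) {ε : ℝ} (hε : 0 < ε) :
    ∃ (N : ℕ) (h : Fin N → G), N ≠ 0 ∧ (∀ j, h j ∈ X) ∧
      ‖conjAverage (fun j => S.lam ρ (h j)) x‖ ≤ ε := by
  have hlim : Filter.Tendsto (fun N : ℕ => 2 * ‖x‖ * √(K / N)) Filter.atTop (nhds 0) := by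
    simpa using (tendsto_const_div_atTop_nhds_zero_nat (K : ℝ)).sqrt.const_mul (2 * ‖x‖)
  obtain ⟨N, hN, hNε⟩ :=
    ((Filter.eventually_ne_atTop 0).and (hlim.eventually_le_const hε)).exists
  obtain ⟨h, T, hhX, hK, hT⟩ := hX N
  refine ⟨N, h, hN, hhX, (norm_conjAverage_lam_le hT hK hx).trans ?_⟩
  rwa [Fintype.card_fin]

theorem conjAverage_lam_mem_supportedOn_conjugatesBy {ι : Type*} [Fintype ι] (h : ι → G) {f : G}
    {M : Set G} {x : S.redCrossedProduct ρ} (hx : x ∈ S.supportedOn ρ (conjugatesBy f M)) :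
    conjAverage (fun j => S.lam ρ (h j)) x ∈
      S.supportedOn ρ (conjugatesBy f (Set.image2 (· * ·) (Set.range h) M)) := by
  rw [conjAverage_apply]
  refine Submodule.smul_of_tower_mem _ _ (sum_mem fun j _ => lam_conj_mem_supportedOn ?_ hx)
  rintro _ ⟨m, hm, rfl⟩
  exact ⟨h j * m, ⟨h j, ⟨j, rfl⟩, m, hm, rfl⟩, by simp only [mul_assoc, mul_inv_rev]⟩

theorem exists_isConjAveraging_norm_le_of_isCPowersSet {n : ℕ} {f : Fin n → G}
    {K : Fin n → Subgroup G} (hK : Monotone K) (hf : ∀ j, IsCPowersSet (K j : Set G) (f j))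
    {M : Fin n → Set G} (hM : ∀ j, (M j).Finite) (hne : ∀ j, (M j).Nonempty) (hMK : ∀ j, M j ⊆ K j)
    {x : Fin n → S.redCrossedProduct ρ}
    (hx : ∀ j, x j ∈ S.supportedOn ρ (conjugatesBy (f j) (M j))) {ε : ℝ} (hε : 0 < ε) :
    ∃ Φ, IsConjAveraging (S.lamGroup ρ) Φ ∧ ∀ j, ‖Φ (x j)‖ ≤ ε := by
  induction n with
  | zero => exact ⟨_, isConjAveraging_id, fun j => j.elim0⟩
  | succ n ih =>
    obtain ⟨N, h, hN, hhK, hle⟩ := exists_norm_conjAverage_lam_le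
      (hf 0 (M 0) (hM 0) (hne 0) (hMK 0)).isPowersSetOfMultiplicity_one (hx 0) hε
    have : NeZero N := ⟨hN⟩
    have hMK' (j : Fin n) : Set.image2 (· * ·) (Set.range h) (M j.succ) ⊆ K j.succ := by
      rintro _ ⟨_, ⟨i, rfl⟩, m, hm, rfl⟩
      exact mul_mem (hK (Fin.zero_le j.succ) (hhK i)) (hMK j.succ hm)
    obtain ⟨Φ, hΦ, hΦx⟩ := ih (hK.comp Fin.strictMono_succ.monotone) (fun j => hf j.succ)
      (fun j => (Set.finite_range h).image2 _ (hM j.succ))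
      (fun j => (Set.range_nonempty h).image2 (hne j.succ)) hMK'
      (fun j => conjAverage_lam_mem_supportedOn_conjugatesBy h (hx j.succ))
    refine ⟨Φ ∘ₗ conjAverage fun j => S.lam ρ (h j),
      hΦ.comp (isConjAveraging_conjAverage_lam h), Fin.cases ?_ hΦx⟩
    exact (hΦ.norm_apply_le _).trans hle

theorem exists_sum_eq_of_mem_supportedOn_range {ι : Type*} [Fintype ι] {f : ι → G}
    {x : S.redCrossedProduct ρ} (hx : x ∈ S.supportedOn ρ (Set.range f)) :
    ∃ z : ι → S.redCrossedProduct ρ, (∀ j, z j ∈ S.supportedOn ρ {f j}) ∧ ∑ j, z j = x := by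
  rw [← Set.iUnion_singleton_eq_range, supportedOn_iUnion,
    Submodule.mem_iSup_iff_exists_finsupp] at hx
  obtain ⟨z, hz, rfl⟩ := hx
  exact ⟨z, hz, (z.sum_fintype (fun _ y => y) fun _ => rfl).symm⟩

theorem exists_isConjAveraging_norm_le_of_isPHGroup (hG : IsPHGroup G) {F : Set G} (hF : F.Finite)
    (hne : F.Nonempty) (h1 : 1 ∉ F) {x : S.redCrossedProduct ρ} (hx : x ∈ S.supportedOn ρ F)
    {ε : ℝ} (hε : 0 < ε) : ∃ Φ, IsConjAveraging (S.lamGroup ρ) Φ ∧ ‖Φ x‖ ≤ ε := by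
  obtain ⟨n, f, K, rfl, hK, hf⟩ := hG F hF hne h1
  obtain ⟨z, hz, rfl⟩ := exists_sum_eq_of_mem_supportedOn_range hx
  have hn : (0 : ℝ) < n := by exact_mod_cast (Set.range_nonempty_iff_nonempty.1 hne).some.pos
  obtain ⟨Φ, hΦ, hle⟩ := exists_isConjAveraging_norm_le_of_isCPowersSet hK hf (M := fun _ => {1})
    (fun _ => Set.finite_singleton _) (fun _ => Set.singleton_nonempty _)
    (fun j => Set.singleton_subset_iff.2 (K j).one_mem)
    (fun j => (conjugatesBy_singleton_one (f j)).symm ▸ hz j) (div_pos hε hn)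
  refine ⟨Φ, hΦ, ?_⟩
  calc ‖Φ (∑ j, z j)‖ ≤ ∑ _j : Fin n, ε / n := by
        rw [map_sum]
        exact norm_sum_le_of_le _ fun j _ => hle j
    _ = ε := by simp [mul_div_cancel₀ _ hn.ne']

theorem exists_isConjAveraging_norm_le_of_hasPCom (hG : HasPCom G) {F : Set G} (hF : F.Finite)
    (hne : F.Nonempty) (h1 : 1 ∉ F) {x : S.redCrossedProduct ρ} (hx : x ∈ S.supportedOn ρ F)
    {ε : ℝ} (hε : 0 < ε) : ∃ Φ, IsConjAveraging (S.lamGroup ρ) Φ ∧ ‖Φ x‖ ≤ ε := by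
  obtain ⟨K, hK⟩ := hG.exists_isPowersSetOfMultiplicity hF hne h1
  obtain ⟨N, h, hN, -, hle⟩ := exists_norm_conjAverage_lam_le hK hx hε
  have : NeZero N := ⟨hN⟩
  exact ⟨_, isConjAveraging_conjAverage_lam h, hle⟩

theorem exists_isConjAveraging_norm_le (hG : IsPHGroup G ∨ HasPCom G) {F : Set G} (hF : F.Finite)
    (h1 : 1 ∉ F) {x : S.redCrossedProduct ρ} (hx : x ∈ S.supportedOn ρ F) {ε : ℝ} (hε : 0 < ε) :
    ∃ Φ, IsConjAveraging (S.lamGroup ρ) Φ ∧ ‖Φ x‖ ≤ ε := by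
  rcases F.eq_empty_or_nonempty with rfl | hne
  · have hx0 : x = 0 := by simpa [supportedOn] using hx
    exact ⟨_, isConjAveraging_id, by simpa [hx0] using hε.le⟩
  · exact hG.elim (exists_isConjAveraging_norm_le_of_isPHGroup · hF hne h1 hx hε)
      (exists_isConjAveraging_norm_le_of_hasPCom · hF hne h1 hx hε)

theorem norm_compress_le (T : L2 G H →L[ℂ] L2 G H) : ‖compress G H T‖ ≤ ‖T‖ := by
  classical
  refine ContinuousLinearMap.opNorm_le_bound _ (norm_nonneg _) fun v => ?_
  calc ‖compress G H T v‖ = ‖T (lp.single 2 1 v) 1‖ := rfl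
    _ ≤ ‖T (lp.single 2 1 v)‖ := lp.norm_apply_le_norm two_ne_zero _ _
    _ ≤ ‖T‖ * ‖v‖ := by
      rw [← lp.norm_single (E := fun _ : G => H) two_pos 1 v]
      exact T.le_opNorm _

theorem continuous_condExp (hρ : Function.Injective ρ) : Continuous (S.condExp ρ hρ) := by
  refine AddMonoidHomClass.continuous_of_bound _ 1 fun x => ?_
  rw [← StarAlgHom.norm_map_of_injective ρ hρ, ρ_condExp, one_mul]
  exact norm_compress_le (x : L2 G H →L[ℂ] L2 G H)

theorem mem_closure_supportedOn_univ (x : S.redCrossedProduct ρ) :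
    x ∈ closure (S.supportedOn ρ Set.univ : Set (S.redCrossedProduct ρ)) := by
  have hmap : (S.supportedOn ρ Set.univ).map
      (S.redCrossedProduct ρ).toSubalgebra.toSubmodule.subtype = S.finiteSums ρ := by
    rw [supportedOn, Submodule.map_span, finiteSums]
    congr 1
    ext T
    constructor
    · rintro ⟨_, ⟨a, g, -, rfl⟩, rfl⟩
      exact ⟨a, g, rfl⟩
    · rintro ⟨a, g, rfl⟩
      exact ⟨_, ⟨a, g, Set.mem_univ g, rfl⟩, rfl⟩
  rw [closure_subtype]
  refine closure_mono (fun T hT => ?_) x.2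
  exact hmap.ge (S.adjoin_subset_finiteSums ρ hT)

theorem exists_finite_sub_incl_condExp_mem_supportedOn (hρ : Function.Injective ρ)
    {x : S.redCrossedProduct ρ} (hx : x ∈ S.supportedOn ρ Set.univ) :
    ∃ F : Set G, F.Finite ∧ 1 ∉ F ∧ x - S.incl ρ (S.condExp ρ hρ x) ∈ S.supportedOn ρ F := by
  classical
  have hadd (a b : A) : S.incl ρ (a + b) = S.incl ρ a + S.incl ρ b := map_add (S.inclHom ρ) a b
  have hsmul (c : ℂ) (a : A) : S.incl ρ (c • a) = c • S.incl ρ a := map_smul (S.inclHom ρ) c a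
  have hzero : S.incl ρ 0 = 0 := map_zero (S.inclHom ρ)
  induction hx using Submodule.span_induction with
  | mem x hx =>
    obtain ⟨a, g, -, rfl⟩ := hx
    rw [condExp_incl_mul_lam]
    by_cases hg : g = 1
    · refine ⟨∅, Set.finite_empty, Set.notMem_empty _, ?_⟩
      simp [hg, lam_one]
    · refine ⟨{g}, Set.finite_singleton g, Ne.symm hg, ?_⟩
      rw [if_neg hg, hzero, sub_zero]
      exact incl_mul_lam_mem_supportedOn a rfl
  | zero => exact ⟨∅, Set.finite_empty, Set.notMem_empty _, by simp [hzero]⟩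
  | add x y _ _ hx hy =>
    obtain ⟨F, hF, hF1, hx⟩ := hx
    obtain ⟨F', hF', hF1', hy⟩ := hy
    refine ⟨F ∪ F', hF.union hF', not_or.2 ⟨hF1, hF1'⟩, ?_⟩
    rw [map_add, hadd, add_sub_add_comm]
    exact add_mem (supportedOn_mono Set.subset_union_left hx)
      (supportedOn_mono Set.subset_union_right hy)
  | smul c x _ hx =>
    obtain ⟨F, hF, hF1, hx⟩ := hx
    refine ⟨F, hF, hF1, ?_⟩
    rw [map_smul, hsmul, ← smul_sub]
    exact Submodule.smul_mem _ _ hx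

theorem mem_closure_supportedOn_of_condExp_eq_zero (hρ : Function.Injective ρ)
    {y : S.redCrossedProduct ρ} (hy : S.condExp ρ hρ y = 0) :
    y ∈ closure {z | ∃ F : Set G, F.Finite ∧ 1 ∉ F ∧ z ∈ S.supportedOn ρ F} := by
  have hcont : Continuous fun x => x - S.incl ρ (S.condExp ρ hρ x) :=
    continuous_id.sub ((S.continuous_incl ρ).comp (continuous_condExp hρ))
  have hzero : S.incl ρ 0 = 0 := map_zero (S.inclHom ρ)
  have hmem := map_mem_closure hcont (mem_closure_supportedOn_univ y)
    (t := {z | ∃ F : Set G, F.Finite ∧ 1 ∉ F ∧ z ∈ S.supportedOn ρ F})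
    fun _ => exists_finite_sub_incl_condExp_mem_supportedOn hρ
  simpa only [hy, hzero, sub_zero] using hmem

theorem HasStrongDP.hasDP {hρ : Function.Injective ρ} (h : S.HasStrongDP ρ hρ) :
    S.HasDP ρ hρ := by
  refine fun y hy hE => closure_mono (convexHull_mono ?_) (h y hy hE)
  rintro x ⟨v, -, hx⟩
  exact ⟨v, hx⟩

end TwistedAction

theorem theorem3p8_general {A G H : Type*} [CStarAlgebra A] [Group G]
    [NormedAddCommGroup H] [InnerProductSpace ℂ H] [CompleteSpace H]
    (hG : IsPHGroup G ∨ HasPCom G) (S : TwistedAction A G)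
    (ρ : A →⋆ₐ[ℂ] (H →L[ℂ] H)) (hρ : Function.Injective ρ)
    {y : S.redCrossedProduct ρ} (hy : S.condExp ρ hρ y = 0) :
    0 ∈ closure (convexHull ℝ (conjOrbit (S.lamGroup ρ) y)) := by
  refine zero_mem_closure_convexHull_conjOrbit ?_
    (TwistedAction.mem_closure_supportedOn_of_condExp_eq_zero hρ hy)
  rintro z ⟨F, hF, h1, hz⟩ ε hε
  exact TwistedAction.exists_isConjAveraging_norm_le hG hF h1 hz hε

theorem theorem3p8 {A G H : Type*} [CStarAlgebra A] [Group G]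
    [NormedAddCommGroup H] [InnerProductSpace ℂ H] [CompleteSpace H]
    (hG : IsPHGroup G ∨ HasPCom G)
    (S : TwistedAction A G)
    (ρ : A →⋆ₐ[ℂ] (H →L[ℂ] H)) (hρ : Function.Injective ρ) :
    S.HasDP ρ hρ ∧ S.HasStrongDP ρ hρ := by
  have h : S.HasStrongDP ρ hρ := fun _ _ hy => theorem3p8_general hG S ρ hρ hy
  exact ⟨h.hasDP, h⟩
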